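/- Let $p$ be a prime, $m\ge 1$, and $q=p^m>2$. A linear code $C\subseteq\mathbb{F}_{q^2}^N$ is an $[N,K,d]_{q^2}$ code if $\dim C=K$ and $d$ is the least Hamming weight of a nonzero codeword; it is MDS if $d=N-K+1$. The Hermitian dual $C^{\perp_h}$ consists of all $x\in\mathbb{F}_{q^2}^N$ with $\sum_{i=1}^N x_ic_i^q=0$ for every $c\in C$, and $C$ is a Hermitian $\ell$-dim hull code if $\dim(C\cap C^{\perp_h})=\ell$. Let $n,k$ be nonnegative integers satisfying one of the following conditions, where $r,t,N,i$ denote nonnegative integers: 1. (a) $n=q^2+1$, $k\le q$, $k\ne q-1$; or (b) $n=r(q-1)+1$, $k\le (q+r-1)/2$, $q\equiv r-1 \pmod{2r}$ and $(r,k)\ne(q+1,q)$; or (c) $n=(q^2+2)/3$, $3\mid(q+1)$, $k\le(2q-1)/3$; 2. (a) $n=tq$, $1\le t\le q$, $k\le\lfloor\frac{tq+q-1}{q+1}\rfloor$; or (b) $n=t(q+1)+2$, $1\le t\le q-1$, $k\le t+1$, $(p,t,k)\ne(2,q-1,q-1)$; 3. (a) $(n-1)\mid(q^2-1)$ and $k\le\lfloor\frac{n+q-1}{q+1}\rfloor$;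 or (b) $n=(t+1)N+i$ with $1\le i\le 2$, $N\mid(q^2-1)$, $n_2=\frac{N}{\gcd(N,q+1)}$, $1\le t\le\frac{q-1}{n_2}-1$ and $k\le\lfloor\frac{n+q-1}{q+1}\rfloor$. Then for all integers $s,\ell$ with $1\le s\le k-1$ and $0\le\ell\le k-s$ there exist MDS Hermitian $\ell$-dim hull codes over $\mathbb{F}_{q^2}$ with each of the parameters $$[n-s,\;k-s,\;n-k+1]_{q^2},\qquad [n-s,\;n-k-s,\;k+1]_{q^2},\qquad [n-s,\;n-k,\;k-s+1]_{q^2}.$$ -/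

import Mathlib

/-- A linear code of length `n` over `F` is a linear subspace of `F ^ n`. -/
abbrev LinCode (F : Type*) [Field F] (n : ℕ) : Type _ := Submodule F (Fin n → F)

namespace LinCode

variable {F : Type*} [Field F] {n : ℕ}

/-- The Hermitian inner product `∑ i, x i * (y i) ^ q`; here `F` has `q ^ 2` elements. -/
def hermInner (q : ℕ) (x y : Fin n → F) : F := ∑ i, x i * y i ^ q

/-- The Hermitian dual: all vectors orthogonal to every codeword of `C`. -/
def hermDual (q : ℕ) (C : LinCode F n) : LinCode F n where
  carrier := {x | ∀ c ∈ C, hermInner q x c = 0}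
  add_mem' := by
    intro a b ha hb c hc
    have h1 := ha c hc
    have h2 := hb c hc
    simp only [hermInner] at h1 h2 ⊢
    simp [add_mul, Finset.sum_add_distrib, h1, h2]
  zero_mem' := by
    intro c _
    simp [hermInner]
  smul_mem' := by
    intro r x hx c hc
    have h1 := hx c hc
    simp only [hermInner] at h1 ⊢
    simp [mul_assoc, ← Finset.mul_sum, h1]

/-- The Hermitian hull `C ∩ C^{⊥_h}`. -/
def hermHull (q : ℕ) (C : LinCode F n) : LinCode F n := C ⊓ hermDual q C

/-- `C` is a Hermitian `l`-dim hull code. -/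
def IsHermHullDim (q : ℕ) (C : LinCode F n) (l : ℕ) : Prop :=
  Module.finrank F (hermHull q C) = l

/-- `C` has minimum distance `d`: the least Hamming weight of a nonzero codeword is `d`. -/
def HasMinDist [DecidableEq F] (C : LinCode F n) (d : ℕ) : Prop :=
  IsLeast {w : ℕ | ∃ c ∈ C, c ≠ 0 ∧ hammingNorm c = w} d

/-- `C`, of length `n`, is an `[n, k, d]` code. -/
def HasParams [DecidableEq F] (C : LinCode F n) (k d : ℕ) : Prop :=
  Module.finrank F C = k ∧ HasMinDist C d

/-- `C` is maximum distance separable: its minimum distance is `n - dim C + 1`. -/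
def IsMDS [DecidableEq F] (C : LinCode F n) : Prop :=
  HasMinDist C (n - Module.finrank F C + 1)

end LinCode

/-!
Write `σ` for `x ↦ x ^ q`, the involution of the field `F` of order `q ^ 2`, and call the field of
order `q` fixed by it the subfield. The three required codes are built from a pair `C' ≤ C` of MDS
codes of length `n - s` and dimensions `k - s` and `k` such that `C'` is orthogonal to `C`
(`LinCode.HasNestedPair`). Each of `C'`, `C^⊥` and `C'^⊥` is MDS of the required dimension and
contains `C'` in its hull, so its hull has dimension at least `k - s`
(`LinCode.HasNestedPair.exists_codes`). The hull dimension is then lowered one step at a time: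
multiplying a coordinate `i` by an element of norm other than `1` (there is one as `q > 2`)
replaces the hull by its subspace of words vanishing at `i`
(`LinCode.exists_finrank_hermHull_eq_pred`).

Puncturing `C` and shortening `C'` at the same coordinate lowers `n` and `dim C'` by one and keeps
`dim C` (`LinCode.HasNestedPair.puncture_shorten`). As `s ≥ 1`, it therefore suffices to have either
a self-orthogonal MDS code of length `n` and dimension `k`, or a pair of length `n - 1` with
dimensions `k - 1` and `k`. The second alternative takes the place of evaluation at the point at
infinity, and asks for less than a self-orthogonal code of length `n`.

The pairs consist of generalized Reed–Solomon codes on a set `A` with weights `w x` in the subfield,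
which are norms and hence come from column multipliers. Orthogonality says that
`∑ x ∈ A, w x * x ^ (e + q * f) = 0` for `e < dim C'` and `f < dim C`. Take for `A` the set of roots
of a monic divisor `P` of `X ^ (q ^ 2) - X` and for `w x` the inverse of `P'(x)`, up to a constant.
Euler's identity gives the vanishing for exponents up to `|A| - 2`, and it remains to see that
`P'` takes values in a fixed multiple of the subfield (`LinCode.hasNestedPair_of_dvd`). Three
choices of `P` cover all parameters:

* `X * ∏ y ∈ Y, (X ^ g - y)` with `g ∣ q + 1` and `Y` a set of nonzero elements of the subfield
  (`LinCode.hasNestedPair_power_fibres`). This covers `n = q ^ 2 + 1`, `n = t * (q + 1) + 2`,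
  `n - 1 ∣ q ^ 2 - 1` and `n = (t + 1) * N + i`; in the last two cases `g` is the greatest common
  divisor of `q + 1` and `n - 1` or `N`.
* `∏ z, (X ^ q - X - z)` over elements `z` with `σ z = -z`
  (`LinCode.hasNestedPair_additive_cosets`). This covers `n = t * q`.
* `X * (X ^ M - 1)` with `M = r * (q - 1)` and `(q + 1) / r` odd
  (`LinCode.hasNestedPair_roots_of_unity`). Exponents beyond `|A| - 2` are reduced modulo `M`, and
  no nonzero exponent that occurs is divisible by `M`. This covers `n = r * (q - 1) + 1`, and
  `n = (q ^ 2 + 2) / 3` with `r = (q + 1) / 3`.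
-/

namespace LinCode

open Polynomial

/-! ### MDS codes -/

section MDS

variable {F : Type*} [Field F] [DecidableEq F] {n k : ℕ}

/-- `C` has dimension `k` and meets the Singleton bound: its nonzero words have weight at least
`n - k + 1`. The bound is stated without subtraction, and the zero code and the full space
qualify. -/
def IsMDSOfDim (C : LinCode F n) (k : ℕ) : Prop :=
  Module.finrank F C = k ∧ ∀ c ∈ C, c ≠ 0 → n + 1 ≤ k + hammingNorm c

theorem hammingNorm_add_card_le {c : Fin n → F} {I : Finset (Fin n)} (h : ∀ i ∈ I, c i = 0) :
    hammingNorm c + I.card ≤ n := by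
  have hd : Disjoint (Finset.univ.filter fun i => c i ≠ 0) I := by
    rw [Finset.disjoint_left]
    intro i hi hI
    exact (Finset.mem_filter.1 hi).2 (h i hI)
  calc hammingNorm c + I.card = ((Finset.univ.filter fun i => c i ≠ 0) ∪ I).card :=
        (Finset.card_union_of_disjoint hd).symm
    _ ≤ n := by simpa using Finset.card_le_univ (_ : Finset (Fin n))

theorem eq_zero_of_eqOn_zero {C : LinCode F n}
    (hC : ∀ c ∈ C, c ≠ 0 → n + 1 ≤ k + hammingNorm c) {I : Finset (Fin n)} (hI : I.card = k)
    {c : Fin n → F} (hc : c ∈ C) (h : ∀ i ∈ I, c i = 0) : c = 0 := by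
  by_contra h0
  have h1 := hC c hc h0
  have h2 := hammingNorm_add_card_le h
  omega

/-- Restriction of the words of `C` to a set of coordinates. -/
def restrict (C : LinCode F n) (I : Finset (Fin n)) : C →ₗ[F] (I → F) :=
  (LinearMap.funLeft F F (fun i : I => (i : Fin n))).comp C.subtype

theorem restrict_injective {C : LinCode F n}
    (hC : ∀ c ∈ C, c ≠ 0 → n + 1 ≤ k + hammingNorm c) {I : Finset (Fin n)} (hI : I.card = k) :
    Function.Injective (restrict C I) := by
  rw [← LinearMap.ker_eq_bot, LinearMap.ker_eq_bot']
  rintro ⟨c, hc⟩ h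
  ext1
  exact eq_zero_of_eqOn_zero hC hI hc fun i hi => congrFun h ⟨i, hi⟩

/-- The Singleton bound. -/
theorem finrank_le_of_le_hammingNorm {C : LinCode F n} (hk : k ≤ n)
    (hC : ∀ c ∈ C, c ≠ 0 → n + 1 ≤ k + hammingNorm c) : Module.finrank F C ≤ k := by
  obtain ⟨I, hI⟩ : ∃ I : Finset (Fin n), I.card = k := by
    obtain ⟨I, -, hI⟩ := Finset.exists_subset_card_eq
      (show k ≤ (Finset.univ : Finset (Fin n)).card by simpa using hk)
    exact ⟨I, hI⟩
  have := LinearMap.finrank_le_finrank_of_injective (restrict_injective hC hI)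
  simpa [hI] using this

theorem IsMDSOfDim.dim_le {C : LinCode F n} (hC : IsMDSOfDim C k) : k ≤ n := by
  have := Submodule.finrank_le C
  rw [hC.1] at this
  simpa using this

/-- Every set of `k` coordinates of an MDS code of dimension `k` is an information set. -/
theorem IsMDSOfDim.exists_eqOn {C : LinCode F n} (hC : IsMDSOfDim C k) {I : Finset (Fin n)}
    (hI : I.card = k) (y : Fin n → F) : ∃ c ∈ C, ∀ i ∈ I, c i = y i := by
  have hs : Function.Surjective (restrict C I) :=
    (LinearMap.injective_iff_surjective_of_finrank_eq_finrank (by simp [hC.1, hI])).1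
      (restrict_injective hC.2 hI)
  obtain ⟨c, hc⟩ := hs fun i => y i
  exact ⟨c, c.2, fun i hi => congrFun hc ⟨i, hi⟩⟩

theorem IsMDSOfDim.hasMinDist {C : LinCode F n} (hC : IsMDSOfDim C k) (hk : 1 ≤ k) :
    HasMinDist C (n - k + 1) := by
  have hkn := hC.dim_le
  constructor
  · obtain ⟨I, -, hI⟩ := Finset.exists_subset_card_eq
      (show k ≤ (Finset.univ : Finset (Fin n)).card by simpa using hkn)
    obtain ⟨i, hi⟩ := Finset.card_pos.1 (by omega : 0 < I.card)
    obtain ⟨c, hc, hcI⟩ := hC.exists_eqOn hI (Pi.single i 1)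
    have hci : c i = 1 := by rw [hcI i hi, Pi.single_eq_same]
    have hc0 : c ≠ 0 := by
      rintro rfl
      simp at hci
    refine ⟨c, hc, hc0, ?_⟩
    have h1 := hC.2 c hc hc0
    have h2 : hammingNorm c + (I.erase i).card ≤ n := by
      apply hammingNorm_add_card_le
      intro j hj
      rw [hcI j (Finset.mem_of_mem_erase hj), Pi.single_eq_of_ne (Finset.ne_of_mem_erase hj)]
    rw [Finset.card_erase_of_mem hi] at h2
    omega
  · rintro w ⟨c, hc, h0, rfl⟩
    have := hC.2 c hc h0
    omega

theorem IsMDSOfDim.hasParams {C : LinCode F n} (hC : IsMDSOfDim C k) (hk : 1 ≤ k) :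
    C.HasParams k (n - k + 1) :=
  ⟨hC.1, hC.hasMinDist hk⟩

theorem IsMDSOfDim.isMDS {C : LinCode F n} (hC : IsMDSOfDim C k) (hk : 1 ≤ k) : C.IsMDS := by
  rw [IsMDS, hC.1]
  exact hC.hasMinDist hk

end MDS

/-! ### The Hermitian dual -/

section Dual

variable {F : Type*} [Field F] {n q : ℕ}

theorem hermInner_conj_symm {σ : F →+* F} (hσ : ∀ x, σ x = x ^ q) (hσ2 : ∀ x, σ (σ x) = x)
    (x y : Fin n → F) : hermInner q x y = σ (hermInner q y x) := by
  simp only [hermInner, ← hσ, map_sum, map_mul, hσ2]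
  exact Finset.sum_congr rfl fun i _ => mul_comm _ _

theorem mem_hermDual {C : LinCode F n} {x : Fin n → F} :
    x ∈ hermDual q C ↔ ∀ c ∈ C, hermInner q x c = 0 := Iff.rfl

theorem hermDual_anti {C D : LinCode F n} (h : C ≤ D) : hermDual q D ≤ hermDual q C :=
  fun _ hx c hc => hx c (h hc)

theorem le_hermDual_hermDual {σ : F →+* F} (hσ : ∀ x, σ x = x ^ q) (hσ2 : ∀ x, σ (σ x) = x)
    (C : LinCode F n) : C ≤ hermDual q (hermDual q C) := by
  intro x hx y hy
  rw [hermInner_conj_symm hσ hσ2, mem_hermDual.1 hy x hx, map_zero]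

/-- The dual is the kernel of the conjugate of a generator matrix, and conjugation preserves the
linear independence of its rows. -/
theorem finrank_hermDual {σ : F →+* F} (hσ : ∀ x, σ x = x ^ q) (hσ2 : ∀ x, σ (σ x) = x)
    (C : LinCode F n) : Module.finrank F (hermDual q C) = n - Module.finrank F C := by
  let b := Module.finBasis F C
  let M : Matrix (Fin (Module.finrank F C)) (Fin n) F := fun j i => σ ((b j : Fin n → F) i)
  have hM : LinearIndependent F M.row := by
    rw [Fintype.linearIndependent_iff]
    intro a ha j
    have h1 : ∑ j, σ (a j) • b j = 0 := by
      ext i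
      have h2 := congrArg σ (congrFun ha i)
      simpa [M, Matrix.row, Finset.sum_apply, map_sum, hσ2] using h2
    have h3 := Fintype.linearIndependent_iff.1 b.linearIndependent (fun j => σ (a j)) h1 j
    exact (map_eq_zero σ).1 h3
  have hker : hermDual q C = LinearMap.ker M.mulVecLin := by
    ext x
    have hr : ∀ j, (M.mulVecLin x) j = hermInner q x (b j : Fin n → F) := by
      intro j
      simp only [Matrix.mulVecLin_apply, Matrix.mulVec, dotProduct, hermInner, ← hσ]
      exact Finset.sum_congr rfl fun i _ => mul_comm (M j i) (x i)
    rw [mem_hermDual, LinearMap.mem_ker]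
    constructor
    · intro h
      ext j
      rw [hr, h _ (b j).2, Pi.zero_apply]
    · intro h c hc
      have hsum : c = ∑ j, b.repr ⟨c, hc⟩ j • (b j : Fin n → F) := by
        have := congrArg C.subtype (b.sum_repr ⟨c, hc⟩)
        rw [map_sum] at this
        exact this.symm
      have : hermInner q x c
          = ∑ j, σ (b.repr ⟨c, hc⟩ j) * hermInner q x (b j : Fin n → F) := by
        conv_lhs => rw [hsum]
        simp only [hermInner, ← hσ, Finset.sum_apply, Pi.smul_apply, smul_eq_mul, map_sum, map_mul,
          Finset.mul_sum]
        rw [Finset.sum_comm]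
        exact Finset.sum_congr rfl fun _ _ => Finset.sum_congr rfl fun _ _ => by ring
      rw [this]
      refine Finset.sum_eq_zero fun j _ => ?_
      rw [← hr j, h, Pi.zero_apply, mul_zero]
  have hrk : M.rank = Module.finrank F C := by simpa using hM.rank_matrix
  have := LinearMap.finrank_range_add_finrank_ker M.mulVecLin
  rw [hker]
  rw [Matrix.rank] at hrk
  simp at this
  omega

theorem IsMDSOfDim.hermDual [DecidableEq F] {σ : F →+* F} (hσ : ∀ x, σ x = x ^ q)
    (hσ2 : ∀ x, σ (σ x) = x) {k : ℕ} {C : LinCode F n} (hC : IsMDSOfDim C k) :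
    IsMDSOfDim (hermDual q C) (n - k) := by
  refine ⟨by rw [finrank_hermDual hσ hσ2, hC.1], fun x hx h0 => ?_⟩
  by_contra hlt
  have hkn := hC.dim_le
  obtain ⟨I, hsub, -, hI⟩ := Finset.exists_subsuperset_card_eq
    (Finset.subset_univ (Finset.univ.filter fun i => x i ≠ 0)) (n := k)
    (by change hammingNorm x ≤ k; omega) (by simpa using hkn)
  obtain ⟨i, hi⟩ := Function.ne_iff.1 h0
  -- A word of `C` equal to the `i`-th unit vector on a superset of the support of `x`.
  obtain ⟨c, hc, hcI⟩ := hC.exists_eqOn hI (Pi.single i 1)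
  have hq : q ≠ 0 := by
    rintro rfl
    simpa using hσ 0
  have hxc := hx c hc
  rw [hermInner, Finset.sum_eq_single i] at hxc
  · rw [hcI i (hsub (by simpa using hi)), Pi.single_eq_same, one_pow, mul_one] at hxc
    exact hi hxc
  · intro j _ hj
    by_cases hxj : x j = 0
    · rw [hxj, zero_mul]
    · rw [hcI j (hsub (by simpa using hxj)), Pi.single_eq_of_ne hj, zero_pow hq, mul_zero]
  · simp

end Dual

/-! ### Lowering the dimension of the hull -/

section Hull

variable {F : Type*} [Field F] {n q : ℕ}

/-- The linear automorphism of `F ^ n` multiplying the coordinates by the entries of `v`. -/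
def scale (v : Fin n → Fˣ) : (Fin n → F) ≃ₗ[F] (Fin n → F) :=
  LinearEquiv.piCongrRight fun i => LinearEquiv.smulOfUnit (v i)

@[simp] theorem scale_apply (v : Fin n → Fˣ) (x : Fin n → F) (i : Fin n) :
    scale v x i = v i * x i := rfl

theorem IsMDSOfDim.map_scale [DecidableEq F] {k : ℕ} {C : LinCode F n} (hC : IsMDSOfDim C k)
    (v : Fin n → Fˣ) : IsMDSOfDim (C.map (scale v).toLinearMap) k := by
  refine ⟨by rw [← hC.1]; exact LinearEquiv.finrank_map_eq (scale v) C, ?_⟩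
  rintro _ ⟨c, hc, rfl⟩ h0
  have hc0 : c ≠ 0 := by
    rintro rfl
    simp at h0
  have : hammingNorm (scale v c) = hammingNorm c := by
    simp [hammingNorm]
  simpa [this] using hC.2 c hc hc0

/-- Multiplying one coordinate, at which the hull does not vanish, by an element of norm other
than `1` replaces the hull by (the image of) its subspace of words vanishing at that coordinate. -/
theorem exists_finrank_hermHull_eq_pred {σ : F →+* F} (hσ : ∀ x, σ x = x ^ q)
    (hσ2 : ∀ x, σ (σ x) = x) {u : Fˣ} (hu : (u : F) ^ (q + 1) ≠ 1) {C : LinCode F n} {l : ℕ}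
    (hl : Module.finrank F (hermHull q C) = l + 1) :
    ∃ v : Fin n → Fˣ, Module.finrank F (hermHull q (C.map (scale v).toLinearMap)) = l := by
  have hpos : 0 < Module.finrank F (hermHull q C) := by omega
  obtain ⟨⟨h, hh⟩, hne⟩ := (Module.finrank_pos_iff_exists_ne_zero (R := F)).1 hpos
  obtain ⟨i, hi⟩ := Function.ne_iff.1 (fun h0 => hne (Subtype.ext h0) : h ≠ 0)
  let v : Fin n → Fˣ := Function.update 1 i u
  have hsc : ∀ x y : Fin n → F, hermInner q (scale v x) (scale v y)
      = hermInner q x y + ((u : F) ^ (q + 1) - 1) * (x i * y i ^ q) := by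
    intro x y
    simp only [hermInner, scale_apply]
    rw [← Finset.add_sum_erase _ _ (Finset.mem_univ i),
      ← Finset.add_sum_erase _ (fun i => x i * y i ^ q) (Finset.mem_univ i)]
    have : ∑ j ∈ Finset.univ.erase i, (v j : F) * x j * (v j * y j) ^ q
        = ∑ j ∈ Finset.univ.erase i, x j * y j ^ q := by
      refine Finset.sum_congr rfl fun j hj => ?_
      simp [v, Function.update_of_ne (Finset.ne_of_mem_erase hj)]
    rw [this]
    simp only [v, Function.update_self]
    ring
  let K : LinCode F n := hermHull q C ⊓ LinearMap.ker (LinearMap.proj i : (Fin n → F) →ₗ[F] F)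
  have hmap : hermHull q (C.map (scale v).toLinearMap) = K.map (scale v).toLinearMap := by
    apply le_antisymm
    · rintro _ ⟨⟨x, hx, rfl⟩, hd⟩
      have hd' : ∀ y ∈ C,
          hermInner q x y + ((u : F) ^ (q + 1) - 1) * (x i * y i ^ q) = 0 := by
        intro y hy
        rw [← hsc]
        exact hd _ ⟨y, hy, rfl⟩
      -- Orthogonality to `h`, which lies in the hull and has `h i ≠ 0`, forces `x i = 0`.
      have hxi : x i = 0 := by
        have h1 := hd' h hh.1
        rw [hermInner_conj_symm hσ hσ2, hh.2 x hx, map_zero, zero_add] at h1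
        rcases mul_eq_zero.1 h1 with h2 | h2
        · exact absurd (sub_eq_zero.1 h2) hu
        · rcases mul_eq_zero.1 h2 with h3 | h3
          · exact h3
          · exact absurd (eq_zero_of_pow_eq_zero h3) hi
      refine ⟨x, ⟨⟨hx, fun y hy => ?_⟩, hxi⟩, rfl⟩
      simpa [hxi] using hd' y hy
    · rintro _ ⟨x, ⟨⟨hx, hd⟩, hxi⟩, rfl⟩
      refine ⟨⟨x, hx, rfl⟩, ?_⟩
      rintro _ ⟨y, hy, rfl⟩
      have hxi' : x i = 0 := hxi
      change hermInner q (scale v x) (scale v y) = 0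
      rw [hsc, hd y hy, hxi']
      simp
  refine ⟨v, ?_⟩
  rw [hmap, LinearEquiv.finrank_map_eq (scale v) K]
  let f : hermHull q C →ₗ[F] F :=
    (LinearMap.proj i : (Fin n → F) →ₗ[F] F).comp (hermHull q C).subtype
  have hf : f ≠ 0 := fun h0 => hi (by simpa [f] using LinearMap.congr_fun h0 ⟨h, hh⟩)
  have hK : Module.finrank F K = Module.finrank F (LinearMap.ker f) := by
    have : K = (LinearMap.ker f).map (hermHull q C).subtype := by
      rw [LinearMap.ker_comp, Submodule.map_comap_subtype]
    rw [this]
    exact Submodule.finrank_map_subtype_eq _ _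
  have h1 := LinearMap.finrank_range_add_finrank_ker f
  rw [LinearMap.range_eq_top.2 (LinearMap.surjective hf), finrank_top, Module.finrank_self] at h1
  omega

/-- An MDS code whose hull has dimension at least `l` is equivalent to one with a hull of
dimension exactly `l`. -/
theorem IsMDSOfDim.exists_isHermHullDim [DecidableEq F] {σ : F →+* F} (hσ : ∀ x, σ x = x ^ q)
    (hσ2 : ∀ x, σ (σ x) = x) {u : Fˣ} (hu : (u : F) ^ (q + 1) ≠ 1) {k l : ℕ} {C : LinCode F n}
    (hC : IsMDSOfDim C k) (hl : l ≤ Module.finrank F (hermHull q C)) :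
    ∃ D : LinCode F n, IsMDSOfDim D k ∧ D.IsHermHullDim q l := by
  obtain ⟨j, hj⟩ := Nat.exists_eq_add_of_le hl
  induction j generalizing C with
  | zero => exact ⟨C, hC, hj⟩
  | succ j ih =>
    obtain ⟨v, hv⟩ := exists_finrank_hermHull_eq_pred hσ hσ2 hu (C := C) (l := l + j) hj
    exact ih (hC.map_scale v) (by omega) hv

end Hull

/-! ### Nested pairs of MDS codes -/

section NestedPair

variable {F : Type*} [Field F] [DecidableEq F] {n q : ℕ}

/-- There are MDS codes `C' ≤ C` of length `n` and dimensions `k'` and `k` such that `C'` is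
contained in the Hermitian dual of `C`, hence in the hull of `C`. For `k' = k` this says that there
is a Hermitian self-orthogonal MDS code of dimension `k`. -/
def HasNestedPair (F : Type*) [Field F] [DecidableEq F] (q n k k' : ℕ) : Prop :=
  ∃ C C' : LinCode F n, C' ≤ C ∧ C' ≤ hermDual q C ∧ IsMDSOfDim C k ∧ IsMDSOfDim C' k'

theorem HasNestedPair.add_le {σ : F →+* F} (hσ : ∀ x, σ x = x ^ q) (hσ2 : ∀ x, σ (σ x) = x)
    {k k' : ℕ} (h : HasNestedPair F q n k k') : k' + k ≤ n := by
  obtain ⟨C, C', -, h2, hC, hC'⟩ := h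
  have h3 := Submodule.finrank_mono h2
  rw [finrank_hermDual hσ hσ2, hC.1, hC'.1] at h3
  have := hC.dim_le
  omega

/-- Puncturing `C` and shortening `C'` at the same coordinate. -/
theorem HasNestedPair.puncture_shorten {σ : F →+* F} (hσ : ∀ x, σ x = x ^ q)
    (hσ2 : ∀ x, σ (σ x) = x) {k k' : ℕ} (h : HasNestedPair F q (n + 1) k (k' + 1)) :
    HasNestedPair F q n k k' := by
  have hle := h.add_le hσ hσ2
  obtain ⟨C, C', h1, h2, hC, hC'⟩ := h
  let tl : (Fin (n + 1) → F) →ₗ[F] (Fin n → F) := LinearMap.funLeft F F Fin.succ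
  let hd : (Fin (n + 1) → F) →ₗ[F] F := LinearMap.proj 0
  have hwt : ∀ c : Fin (n + 1) → F,
      hammingNorm c = (if c 0 = 0 then 0 else 1) + hammingNorm (tl c) := by
    intro c
    have : hammingNorm (tl c) = (Finset.univ.filter fun i : Fin n => c i.succ ≠ 0).card := rfl
    rw [this, hammingNorm, Fin.card_filter_univ_succ]
    by_cases h0 : c 0 = 0
    · simp [h0]
    · simp [h0, add_comm]
  have hwt_le : ∀ c : Fin (n + 1) → F, hammingNorm c ≤ 1 + hammingNorm (tl c) := by
    intro c
    rw [hwt]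
    split_ifs <;> omega
  have hinj : ∀ c ∈ C, tl c = 0 → c = 0 := by
    intro c hc h0
    by_contra hne
    have h3 := hC.2 c hc hne
    have h4 := hwt_le c
    rw [h0, hammingNorm_zero] at h4
    omega
  have hCt : IsMDSOfDim (C.map tl) k := by
    constructor
    · rw [← hC.1]
      refine (LinearEquiv.ofBijective (tl.submoduleMap C)
        ⟨?_, tl.submoduleMap_surjective C⟩).symm.finrank_eq
      rw [← LinearMap.ker_eq_bot, LinearMap.ker_eq_bot']
      rintro ⟨c, hc⟩ h0
      exact Subtype.ext (hinj c hc (congrArg Subtype.val h0))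
    · rintro _ ⟨c, hc, rfl⟩ h0
      have h3 := hC.2 c hc (by rintro rfl; simp at h0)
      have h4 := hwt_le c
      omega
  let S : LinCode F (n + 1) := C' ⊓ LinearMap.ker hd
  have hSinj : ∀ c ∈ S, tl c = 0 → c = 0 := fun c hc => hinj c (h1 hc.1)
  have hSd : Module.finrank F (S.map tl) = Module.finrank F S := by
    refine (LinearEquiv.ofBijective (tl.submoduleMap S)
        ⟨?_, tl.submoduleMap_surjective S⟩).symm.finrank_eq
    rw [← LinearMap.ker_eq_bot, LinearMap.ker_eq_bot']
    rintro ⟨c, hc⟩ h0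
    exact Subtype.ext (hSinj c hc (congrArg Subtype.val h0))
  have hSge : k' ≤ Module.finrank F S := by
    have h3 := LinearMap.finrank_range_add_finrank_ker (hd.comp C'.subtype)
    have h4 : Module.finrank F (LinearMap.ker (hd.comp C'.subtype)) = Module.finrank F S := by
      have : S = (LinearMap.ker (hd.comp C'.subtype)).map C'.subtype := by
        rw [LinearMap.ker_comp, Submodule.map_comap_subtype]
      rw [this]
      exact (Submodule.finrank_map_subtype_eq _ _).symm
    have h5 := Submodule.finrank_le (LinearMap.range (hd.comp C'.subtype))
    rw [Module.finrank_self] at h5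
    rw [hC'.1] at h3
    omega
  have hSw : ∀ c ∈ S.map tl, c ≠ 0 → n + 1 ≤ k' + hammingNorm c := by
    rintro _ ⟨c, ⟨hc, hc0⟩, rfl⟩ h0
    have h3 := hC'.2 c hc (by rintro rfl; simp at h0)
    have h4 := hwt c
    rw [if_pos (show c 0 = 0 from hc0)] at h4
    omega
  refine ⟨C.map tl, S.map tl, Submodule.map_mono (inf_le_left.trans h1), ?_, hCt, ?_, hSw⟩
  · rintro _ ⟨x, ⟨hx, hx0⟩, rfl⟩ _ ⟨c, hc, rfl⟩
    have h3 := h2 hx c hc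
    rw [hermInner, Fin.sum_univ_succ, show x 0 = 0 from hx0, zero_mul, zero_add] at h3
    exact h3
  · have := finrank_le_of_le_hammingNorm (by omega) hSw
    omega

theorem HasNestedPair.iterate {σ : F →+* F} (hσ : ∀ x, σ x = x ^ q)
    (hσ2 : ∀ x, σ (σ x) = x) {k k' : ℕ} (s : ℕ)
    (h : HasNestedPair F q (n + s) k (k' + s)) : HasNestedPair F q n k k' := by
  induction s with
  | zero => exact h
  | succ s ih => exact ih (HasNestedPair.puncture_shorten hσ hσ2 h)

/-- Each of `C'`, the dual of `C` and the dual of `C'` has a hull containing `C'`. -/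
theorem HasNestedPair.exists_codes {σ : F →+* F} (hσ : ∀ x, σ x = x ^ q)
    (hσ2 : ∀ x, σ (σ x) = x) {u : Fˣ} (hu : (u : F) ^ (q + 1) ≠ 1) {k k' l : ℕ}
    (h : HasNestedPair F q n k k') (hl : l ≤ k') :
    (∃ C : LinCode F n, IsMDSOfDim C k' ∧ C.IsHermHullDim q l) ∧
    (∃ C : LinCode F n, IsMDSOfDim C (n - k) ∧ C.IsHermHullDim q l) ∧
    (∃ C : LinCode F n, IsMDSOfDim C (n - k') ∧ C.IsHermHullDim q l) := by
  obtain ⟨C, C', h1, h2, hC, hC'⟩ := h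
  have key : ∀ D : LinCode F n, C' ≤ hermHull q D → l ≤ Module.finrank F (hermHull q D) :=
    fun D hD => hl.trans (hC'.1 ▸ Submodule.finrank_mono hD)
  refine ⟨hC'.exists_isHermHullDim hσ hσ2 hu (key _ ?_),
    (hC.hermDual hσ hσ2).exists_isHermHullDim hσ hσ2 hu (key _ ?_),
    (hC'.hermDual hσ hσ2).exists_isHermHullDim hσ hσ2 hu (key _ ?_)⟩
  · exact le_inf le_rfl (h2.trans (hermDual_anti h1))
  · exact le_inf h2 (h1.trans (le_hermDual_hermDual hσ hσ2 C))
  · exact le_inf (h2.trans (hermDual_anti h1)) (le_hermDual_hermDual hσ hσ2 C')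

end NestedPair

/-! ### Generalized Reed–Solomon codes -/

section GRS

variable {F : Type*} [Field F] {n q : ℕ}

/-- The weighted evaluation map of polynomials at the points `a i`. -/
noncomputable def evalMap (a v : Fin n → F) : F[X] →ₗ[F] (Fin n → F) :=
  LinearMap.pi fun i => v i • Polynomial.leval (a i)

@[simp] theorem evalMap_apply (a v : Fin n → F) (f : F[X]) (i : Fin n) :
    evalMap a v f i = v i * f.eval (a i) := rfl

/-- The generalized Reed–Solomon code of dimension `k` with evaluation points `a i` and column
multipliers `v i`. -/
noncomputable def grs (a v : Fin n → F) (k : ℕ) : LinCode F n := (degreeLT F k).map (evalMap a v)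

theorem add_le_hammingNorm_evalMap [DecidableEq F] {a v : Fin n → F} (ha : Function.Injective a)
    (hv : ∀ i, v i ≠ 0) {k : ℕ} {f : F[X]} (hf : f ∈ degreeLT F k) (h0 : f ≠ 0) :
    n + 1 ≤ k + hammingNorm (evalMap a v f) := by
  have h1 : (Finset.univ.filter fun i => evalMap a v f i = 0).card < k := by
    have h2 : (Finset.univ.filter fun i => evalMap a v f i = 0).image a ⊆ f.roots.toFinset := by
      intro x hx
      obtain ⟨i, hi, rfl⟩ := Finset.mem_image.1 hx
      simpa [h0, hv i] using hi
    calc (Finset.univ.filter fun i => evalMap a v f i = 0).card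
        = ((Finset.univ.filter fun i => evalMap a v f i = 0).image a).card :=
          (Finset.card_image_of_injective _ ha).symm
      _ ≤ f.roots.toFinset.card := Finset.card_le_card h2
      _ ≤ f.natDegree := (Multiset.toFinset_card_le _).trans (card_roots' f)
      _ < k := (natDegree_lt_iff_degree_lt h0).2 (mem_degreeLT.1 hf)
  have h3 := Finset.card_filter_add_card_filter_not (s := Finset.univ)
    (fun i : Fin n => evalMap a v f i = 0)
  rw [Finset.card_univ, Fintype.card_fin] at h3
  have h4 : hammingNorm (evalMap a v f)
      = (Finset.univ.filter fun i => ¬ evalMap a v f i = 0).card := rfl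
  omega

theorem isMDSOfDim_grs [DecidableEq F] {a v : Fin n → F} (ha : Function.Injective a)
    (hv : ∀ i, v i ≠ 0) {k : ℕ} (hk : k ≤ n) : IsMDSOfDim (grs a v k) k := by
  constructor
  · have h1 : Module.finrank F (degreeLT F k) = k := by
      rw [(degreeLTEquiv F k).finrank_eq, Module.finrank_fin_fun]
    conv_rhs => rw [← h1]
    refine (LinearEquiv.ofBijective ((evalMap a v).submoduleMap (degreeLT F k))
      ⟨?_, (evalMap a v).submoduleMap_surjective _⟩).symm.finrank_eq
    rw [← LinearMap.ker_eq_bot, LinearMap.ker_eq_bot']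
    rintro ⟨f, hf⟩ h0
    by_contra hne
    have h2 := add_le_hammingNorm_evalMap ha hv hf fun h => hne (Subtype.ext h)
    rw [show evalMap a v f = 0 from congrArg Subtype.val h0, hammingNorm_zero] at h2
    omega
  · rintro _ ⟨f, hf, rfl⟩ h0
    exact add_le_hammingNorm_evalMap ha hv hf (by rintro rfl; simp at h0)

theorem grs_mono (a v : Fin n → F) {k k' : ℕ} (h : k' ≤ k) : grs a v k' ≤ grs a v k :=
  Submodule.map_mono (degreeLT_mono h)

theorem eval_eq_sum_of_mem_degreeLT {k : ℕ} {f : F[X]} (hf : f ∈ degreeLT F k) (x : F) :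
    f.eval x = ∑ e ∈ Finset.range k, f.coeff e * x ^ e := by
  rcases eq_or_ne f 0 with rfl | h0
  · simp
  · exact eval_eq_sum_range' ((natDegree_lt_iff_degree_lt h0).2 (mem_degreeLT.1 hf)) x

theorem grs_le_hermDual {σ : F →+* F} (hσ : ∀ x, σ x = x ^ q) {a v : Fin n → F} {k k' : ℕ}
    (h : ∀ e < k', ∀ f < k, ∑ i, v i ^ (q + 1) * a i ^ (e + q * f) = 0) :
    grs a v k' ≤ hermDual q (grs a v k) := by
  rintro _ ⟨f, hf, rfl⟩ _ ⟨g, hg, rfl⟩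
  have h1 : ∀ i, evalMap a v f i * evalMap a v g i ^ q = ∑ e ∈ Finset.range k',
      ∑ j ∈ Finset.range k, f.coeff e * σ (g.coeff j) * (v i ^ (q + 1) * a i ^ (e + q * j)) := by
    intro i
    rw [← hσ, evalMap_apply, evalMap_apply, eval_eq_sum_of_mem_degreeLT hf,
      eval_eq_sum_of_mem_degreeLT hg, map_mul, map_sum, mul_mul_mul_comm, Finset.sum_mul_sum,
      Finset.mul_sum]
    refine Finset.sum_congr rfl fun e _ => ?_
    rw [Finset.mul_sum]
    refine Finset.sum_congr rfl fun j _ => ?_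
    rw [map_mul, map_pow, hσ (v i), hσ (a i), ← pow_mul, pow_add (a i)]
    ring
  rw [hermInner, Finset.sum_congr rfl fun i _ => h1 i, Finset.sum_comm]
  refine Finset.sum_eq_zero fun e he => ?_
  rw [Finset.sum_comm]
  refine Finset.sum_eq_zero fun j hj => ?_
  rw [← Finset.mul_sum, h e (Finset.mem_range.1 he) j (Finset.mem_range.1 hj), mul_zero]

/-- The nonzero elements of the subfield of order `q` are norms. -/
theorem exists_pow_add_one_eq [Fintype F] (hF : Fintype.card F = q ^ 2) {w : F} (h0 : w ≠ 0)
    (hw : w ^ q = w) : ∃ x, x ^ (q + 1) = w := by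
  classical
  have hq : 1 < q := by
    have := Fintype.one_lt_card (α := F)
    by_contra hle
    interval_cases q <;> simp_all
  obtain ⟨z, hz⟩ := IsCyclic.exists_generator (α := Fˣ)
  have hord : orderOf z = (q + 1) * (q - 1) := by
    rw [orderOf_eq_card_of_forall_mem_zpowers hz, Nat.card_eq_fintype_card, Fintype.card_units, hF,
      ← Nat.sq_sub_sq, one_pow]
  obtain ⟨m, hm⟩ := (mem_powers_iff_mem_zpowers.2 (hz (Units.mk0 w h0)))
  have hm' : z ^ m = Units.mk0 w h0 := hm
  have h1 : z ^ (m * (q - 1)) = 1 := by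
    rw [pow_mul, hm']
    ext
    have : w ^ (q - 1) * w = w := by rw [← pow_succ, Nat.sub_add_cancel hq.le, hw]
    simpa [h0] using this
  have h2 := orderOf_dvd_of_pow_eq_one h1
  rw [hord] at h2
  obtain ⟨d, rfl⟩ := Nat.dvd_of_mul_dvd_mul_right (by omega) h2
  refine ⟨((z ^ d : Fˣ) : F), ?_⟩
  rw [← Units.val_pow_eq_pow_val, ← pow_mul, mul_comm, hm', Units.val_mk0]

/-- Weights in the subfield of order `q` orthogonal to the relevant powers turn into column
multipliers of generalized Reed–Solomon codes. -/
theorem hasNestedPair_of_sum_eq_zero [Fintype F] [DecidableEq F] (hF : Fintype.card F = q ^ 2)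
    {σ : F →+* F} (hσ : ∀ x, σ x = x ^ q) {A : Finset F} {w : F → F} (hw0 : ∀ x ∈ A, w x ≠ 0)
    (hw : ∀ x ∈ A, w x ^ q = w x) {k k' : ℕ} (hk' : k' ≤ k) (hk : k ≤ A.card)
    (h : ∀ e < k', ∀ f < k, ∑ x ∈ A, w x * x ^ (e + q * f) = 0) :
    HasNestedPair F q A.card k k' := by
  have hv : ∀ i : Fin A.card, ∃ v, v ^ (q + 1) = w (A.equivFin.symm i) := fun i =>
    exists_pow_add_one_eq hF (hw0 _ (A.equivFin.symm i).2) (hw _ (A.equivFin.symm i).2)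
  choose v hv using hv
  have hv0 : ∀ i, v i ≠ 0 := by
    intro i h0
    apply hw0 _ (A.equivFin.symm i).2
    rw [← hv, h0, zero_pow (Nat.succ_ne_zero q)]
  have ha : Function.Injective fun i => (A.equivFin.symm i : F) :=
    Subtype.val_injective.comp A.equivFin.symm.injective
  refine ⟨grs _ v k, grs _ v k', grs_mono _ _ hk', grs_le_hermDual hσ ?_,
    isMDSOfDim_grs ha hv0 hk, isMDSOfDim_grs ha hv0 (hk'.trans hk)⟩
  intro e he f hf
  rw [← h e he f hf, ← Finset.sum_coe_sort A]
  simp only [hv]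
  exact Equiv.sum_comp A.equivFin.symm fun x : A => w x * (x : F) ^ (e + q * f)

end GRS

/-! ### Weights from the derivative of a split polynomial -/

section Lagrange

variable {F : Type*} [Field F] [Fintype F] [DecidableEq F] {q : ℕ}

theorem nodal_roots_eq_of_dvd {P : F[X]} (hP : P.Monic) (hdvd : P ∣ X ^ Fintype.card F - X) :
    Lagrange.nodal P.roots.toFinset id = P := by
  have h0 : (X ^ Fintype.card F - X : F[X]) ≠ 0 :=
    FiniteField.X_pow_card_sub_X_ne_zero F Fintype.one_lt_card
  have hs : P.Splits := by
    refine Splits.of_dvd ?_ h0 hdvd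
    rw [splits_iff_card_roots, FiniteField.roots_X_pow_card_sub_X,
      FiniteField.X_pow_card_sub_X_natDegree_eq F Fintype.one_lt_card]
    rfl
  have hnd : P.roots.Nodup := by
    refine Multiset.nodup_of_le (roots.le_of_dvd h0 hdvd) ?_
    rw [FiniteField.roots_X_pow_card_sub_X]
    exact Finset.univ.nodup
  conv_rhs => rw [hs.eq_prod_roots_of_monic hP]
  rw [Lagrange.nodal, Finset.prod, Multiset.toFinset_val, hnd.dedup]
  rfl

theorem card_roots_eq_of_dvd {P : F[X]} (hP : P.Monic) (hdvd : P ∣ X ^ Fintype.card F - X) :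
    P.roots.toFinset.card = P.natDegree := by
  conv_rhs => rw [← nodal_roots_eq_of_dvd hP hdvd, Lagrange.natDegree_nodal]

theorem eval_derivative_eq_prod {P : F[X]} (hP : P.Monic) (hdvd : P ∣ X ^ Fintype.card F - X)
    {a : F} (ha : a ∈ P.roots.toFinset) :
    P.derivative.eval a = ∏ b ∈ P.roots.toFinset.erase a, (a - b) := by
  conv_lhs => rw [← nodal_roots_eq_of_dvd hP hdvd]
  have := Lagrange.eval_nodal_derivative_eval_node_eq (v := id) ha
  rw [Lagrange.eval_nodal] at this
  exact this

/-- Euler's identity: `x ^ m / P'(x)` sums to zero over the roots of `P` if `m ≤ deg P - 2`. -/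
theorem sum_pow_div_derivative_eq_zero {P : F[X]} (hP : P.Monic)
    (hdvd : P ∣ X ^ Fintype.card F - X) {m : ℕ} (hm : m + 2 ≤ P.natDegree) :
    ∑ a ∈ P.roots.toFinset, a ^ m / P.derivative.eval a = 0 := by
  have hc := card_roots_eq_of_dvd hP hdvd
  have h1 := Lagrange.coeff_eq_sum (s := P.roots.toFinset) (v := id) (Set.injOn_id _)
    (P := (X ^ m : F[X])) (by rw [degree_X_pow]; exact_mod_cast (by omega))
  rw [coeff_X_pow, if_neg (by omega)] at h1
  rw [h1]
  refine Finset.sum_congr rfl fun a ha => ?_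
  rw [eval_derivative_eq_prod hP hdvd ha]
  simp

/-- If `P'` takes values in a fixed multiple of the subfield of order `q` at the roots of `P`, then
`1 / P'` provides the weights of a nested pair of codes evaluated at these roots. Exponents may be
lowered to at most `deg P - 2` by relations that hold at the roots. -/
theorem hasNestedPair_of_dvd (hF : Fintype.card F = q ^ 2) {σ : F →+* F} (hσ : ∀ x, σ x = x ^ q)
    {P : F[X]} (hP : P.Monic) (hdvd : P ∣ X ^ Fintype.card F - X) {c : F} (hc : c ≠ 0)
    (hcP : ∀ a, P.eval a = 0 → (c * P.derivative.eval a) ^ q = c * P.derivative.eval a)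
    {k k' : ℕ} (hk' : k' ≤ k) (hk : k ≤ P.natDegree)
    (h : ∀ e < k', ∀ f < k, ∃ m, m + 2 ≤ P.natDegree ∧
      ∀ a, P.eval a = 0 → a ^ (e + q * f) = a ^ m) :
    HasNestedPair F q P.natDegree k k' := by
  have hr : ∀ a ∈ P.roots.toFinset, P.eval a = 0 := fun a ha =>
    (mem_roots'.1 (Multiset.mem_toFinset.1 ha)).2
  rw [← card_roots_eq_of_dvd hP hdvd] at hk ⊢
  refine hasNestedPair_of_sum_eq_zero hF hσ (w := fun a => (c * P.derivative.eval a)⁻¹)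
    ?_ ?_ hk' hk ?_
  · intro a ha
    refine inv_ne_zero (mul_ne_zero hc ?_)
    rw [eval_derivative_eq_prod hP hdvd ha, Finset.prod_ne_zero_iff]
    intro b hb
    exact sub_ne_zero.2 (Finset.ne_of_mem_erase hb).symm
  · intro a ha
    rw [inv_pow, hcP a (hr a ha)]
  · intro e he f hf
    obtain ⟨m, hm, ham⟩ := h e he f hf
    have h1 := sum_pow_div_derivative_eq_zero hP hdvd hm
    calc ∑ a ∈ P.roots.toFinset, (c * P.derivative.eval a)⁻¹ * a ^ (e + q * f)
        = c⁻¹ * ∑ a ∈ P.roots.toFinset, a ^ m / P.derivative.eval a := by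
          rw [Finset.mul_sum]
          refine Finset.sum_congr rfl fun a ha => ?_
          rw [ham a (hr a ha), mul_inv, div_eq_mul_inv]
          ring
      _ = 0 := by rw [h1, mul_zero]

end Lagrange

/-! ### Three families of evaluation sets -/

section Families

variable {F : Type*} [Field F] {q : ℕ}

theorem sq_eq_mul_sub_one_add_one (hq : 1 ≤ q) : q ^ 2 = (q + 1) * (q - 1) + 1 := by
  obtain ⟨c, rfl⟩ := Nat.exists_eq_add_of_le' hq
  simp only [Nat.add_sub_cancel]
  ring

theorem eval_fixed_of_map_eq {σ : F →+* F} {H : F[X]} (hH : H.map σ = H) {z : F} (hz : σ z = z) :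
    σ (H.eval z) = H.eval z := by
  rw [← eval_map_apply, hH, hz]

theorem map_prod_X_sub_C_eq {σ : F →+* F} {Z : Finset F} (hZ : ∀ z ∈ Z, σ z = z) :
    (∏ z ∈ Z, (X - C z)).map σ = ∏ z ∈ Z, (X - C z) := by
  rw [Polynomial.map_prod]
  refine Finset.prod_congr rfl fun z hz => ?_
  rw [Polynomial.map_sub, map_X, map_C, hZ z hz]

theorem isCoprime_sub_C_sub_C (h : F[X]) {y z : F} (hyz : y ≠ z) :
    IsCoprime (h - C y) (h - C z) := by
  have h0 : z - y ≠ 0 := sub_ne_zero.2 hyz.symm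
  refine ⟨C (z - y)⁻¹, -C (z - y)⁻¹, ?_⟩
  calc C (z - y)⁻¹ * (h - C y) + -C (z - y)⁻¹ * (h - C z) = C (z - y)⁻¹ * (C z - C y) := by ring
    _ = 1 := by rw [← C_sub, ← C_mul, inv_mul_cancel₀ h0, C_1]

theorem prod_sub_C_dvd {h Q : F[X]} {Z : Finset F} (hZ : ∀ z ∈ Z, h - C z ∣ Q) :
    ∏ z ∈ Z, (h - C z) ∣ Q :=
  Finset.prod_dvd_of_coprime (fun _ _ _ _ hyz => isCoprime_sub_C_sub_C h hyz) hZ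

theorem monic_X_pow_sub_X_sub_C (hq : 1 < q) (z : F) : (X ^ q - X - C z : F[X]).Monic := by
  rw [sub_sub]
  refine (monic_X_pow q).sub_of_left ?_
  rw [degree_X_pow, degree_X_add_C]
  exact_mod_cast hq

theorem natDegree_X_pow_sub_X_sub_C (hq : 1 < q) (z : F) :
    (X ^ q - X - C z : F[X]).natDegree = q := by
  rw [sub_sub, natDegree_sub_eq_left_of_natDegree_lt, natDegree_X_pow]
  rw [natDegree_X_pow, natDegree_X_add_C]
  exact hq

variable [Fintype F]

/-- As `q` is a power of the characteristic, `x ↦ x ^ q` is a field automorphism, and it is an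
involution because `F` has order `q ^ 2`. -/
theorem exists_conj {p m : ℕ} (hp : p.Prime) (hq : q = p ^ m) (hF : Fintype.card F = q ^ 2) :
    ∃ σ : F →+* F, (∀ x, σ x = x ^ q) ∧ ∀ x, σ (σ x) = x := by
  have := Fact.mk hp
  have : CharP F p := charP_of_card_eq_prime_pow (f := m * 2) (by rw [hF, hq, pow_mul])
  have hσ : ∀ x, iterateFrobenius F p m x = x ^ q := fun x => by rw [iterateFrobenius_def, hq]
  refine ⟨iterateFrobenius F p m, hσ, fun x => ?_⟩
  rw [hσ, hσ, ← pow_mul, ← sq, ← hF, FiniteField.pow_card]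

theorem exists_unit_pow_add_one_ne_one (hF : Fintype.card F = q ^ 2) (hq : 2 < q) :
    ∃ u : Fˣ, (u : F) ^ (q + 1) ≠ 1 := by
  classical
  obtain ⟨z, hz⟩ := IsCyclic.exists_generator (α := Fˣ)
  have hord : orderOf z = (q + 1) * (q - 1) := by
    rw [orderOf_eq_card_of_forall_mem_zpowers hz, Nat.card_eq_fintype_card, Fintype.card_units, hF,
      ← Nat.sq_sub_sq, one_pow]
  refine ⟨z, fun h => ?_⟩
  have h1 : z ^ (q + 1) = 1 := by
    ext
    simpa using h
  have h2 := Nat.le_of_dvd (by omega) (orderOf_dvd_of_pow_eq_one h1)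
  rw [hord] at h2
  have h3 : (q + 1) * 2 ≤ (q + 1) * (q - 1) := Nat.mul_le_mul_left _ (by omega)
  omega

/-- The exponent `(q + 1) * (q - 1)` is the order of the multiplicative group. -/
theorem X_mul_dvd_of_dvd {P : F[X]} (hF : Fintype.card F = q ^ 2) (hq : 1 < q)
    (h : P ∣ X ^ ((q + 1) * (q - 1)) - 1) : X * P ∣ X ^ Fintype.card F - X := by
  have h2 : (X ^ Fintype.card F - X : F[X]) = X * (X ^ ((q + 1) * (q - 1)) - 1) := by
    rw [hF, sq_eq_mul_sub_one_add_one hq.le]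
    ring
  rw [h2]
  exact mul_dvd_mul_left X h

/-- Indeed `L ^ q + L = X ^ (q ^ 2) - X` for `L = X ^ q - X`, and `z ^ q + z = 0`. -/
theorem X_pow_sub_X_sub_C_dvd {σ : F →+* F} (hF : Fintype.card F = q ^ 2)
    (hσ : ∀ x, σ x = x ^ q) {p m : ℕ} (hp : p.Prime) (hq : q = p ^ m) {z : F} (hz : σ z = -z) :
    (X ^ q - X - C z : F[X]) ∣ X ^ Fintype.card F - X := by
  have := Fact.mk hp
  have : CharP F p := charP_of_card_eq_prime_pow (f := m * 2) (by rw [hF, hq, pow_mul])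
  have h1 : (X ^ q - X : F[X]) ^ q = X ^ Fintype.card F - X ^ q := by
    conv_lhs => rw [hq, sub_pow_char_pow, ← hq, ← pow_mul, ← sq, ← hF]
  have h2 : (C z : F[X]) ^ q = - C z := by rw [← C_pow, ← hσ, hz, C_neg]
  have h3 : (X ^ Fintype.card F - X : F[X])
      = ((X ^ q - X) ^ q - C z ^ q) + (X ^ q - X - C z) := by
    rw [h1, h2]
    ring
  rw [h3]
  exact dvd_add (sub_dvd_pow_sub_pow _ _ q) dvd_rfl

variable [DecidableEq F]

/-- The elements fixed by `x ↦ x ^ q` form a set (the subfield) of size `q`. -/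
theorem card_filter_fixed {σ : F →+* F} (hF : Fintype.card F = q ^ 2)
    (hσ : ∀ x, σ x = x ^ q) {p m : ℕ} (hp : p.Prime) (hq : q = p ^ m) (hq1 : 1 < q) :
    (Finset.univ.filter fun x : F => σ x = x).card = q := by
  have hdvd := X_pow_sub_X_sub_C_dvd hF hσ hp hq (z := 0) (by simp)
  have hm := monic_X_pow_sub_X_sub_C hq1 (0 : F)
  have h1 := card_roots_eq_of_dvd hm hdvd
  rw [natDegree_X_pow_sub_X_sub_C hq1] at h1
  rw [← h1]
  congr 1
  ext x
  rw [Multiset.mem_toFinset, mem_roots hm.ne_zero]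
  simp [hσ, sub_eq_zero]

/-- The evaluation set `{0} ∪ {x | x ^ g ∈ Y}`, with `g ∣ q + 1` and `Y` a set of `T` nonzero
elements of the subfield of order `q`. -/
theorem hasNestedPair_power_fibres {σ : F →+* F} (hF : Fintype.card F = q ^ 2)
    (hσ : ∀ x, σ x = x ^ q) {p m : ℕ} (hp : p.Prime) (hq : q = p ^ m) (hq1 : 1 < q)
    {g T k k' : ℕ} (hg : g ∣ q + 1) (hT : T ≤ q - 1) (hk' : k' ≤ k) (hk1 : 1 ≤ k)
    (h : k' + q * (k - 1) ≤ g * T) : HasNestedPair F q (g * T + 1) k k' := by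
  obtain ⟨b, hb⟩ := hg
  have hg0 : g ≠ 0 := by
    rintro rfl
    omega
  obtain ⟨Y, hYs, hYc⟩ := Finset.exists_subset_card_eq
    (show T ≤ ((Finset.univ.filter fun x : F => σ x = x).erase 0).card by
      rw [Finset.card_erase_of_mem (by simp), card_filter_fixed hF hσ hp hq hq1]
      exact hT)
  have hY0 : ∀ y ∈ Y, y ≠ 0 := fun y hy => Finset.ne_of_mem_erase (hYs hy)
  have hYσ : ∀ y ∈ Y, σ y = y := fun y hy => by
    simpa using Finset.mem_of_mem_erase (hYs hy)
  set R : F[X] := ∏ y ∈ Y, (X ^ g - C y) with hR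
  have hRm : R.Monic := monic_prod_of_monic _ _ fun y _ => monic_X_pow_sub_C y hg0
  have hRd : R.natDegree = g * T := by
    rw [hR, natDegree_prod_of_monic _ _ fun y _ => monic_X_pow_sub_C y hg0]
    simp [hYc, mul_comm]
  have hRdvd : R ∣ X ^ ((q + 1) * (q - 1)) - 1 := by
    refine prod_sub_C_dvd fun y hy => ?_
    have hy1 : y ^ (q - 1) = 1 := by
      have : y ^ (q - 1) * y = 1 * y := by
        rw [← pow_succ, Nat.sub_add_cancel hq1.le, ← hσ, hYσ y hy, one_mul]
      exact mul_right_cancel₀ (hY0 y hy) this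
    have : (X ^ ((q + 1) * (q - 1)) - 1 : F[X])
        = (X ^ g) ^ (b * (q - 1)) - C y ^ (b * (q - 1)) := by
      rw [← C_pow, mul_comm b, pow_mul y, hy1, one_pow, C_1, ← pow_mul, hb]
      ring
    rw [this]
    exact sub_dvd_pow_sub_pow _ _ _
  set H : F[X] := ∏ y ∈ Y, (X - C y) with hH
  have hHσ : H.map σ = H := map_prod_X_sub_C_eq hYσ
  have hRH : R = H.comp (X ^ g) := by
    rw [hH, prod_comp]
    simp [hR]
  have hPm : (X * R).Monic := monic_X.mul hRm
  have hPd : (X * R).natDegree = g * T + 1 := by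
    rw [monic_X.natDegree_mul hRm, natDegree_X, hRd, add_comm]
  have hkq : k - 1 ≤ q * (k - 1) := Nat.le_mul_of_pos_left _ (by omega)
  rw [← hPd]
  refine hasNestedPair_of_dvd hF hσ hPm (X_mul_dvd_of_dvd hF hq1 hRdvd) one_ne_zero ?_ hk'
    (by omega) ?_
  · intro a ha
    have hag : σ (a ^ g) = a ^ g := by
      rw [eval_mul, eval_X, mul_eq_zero] at ha
      rcases ha with rfl | ha
      · simp [hg0]
      · rw [hR, eval_prod, Finset.prod_eq_zero_iff] at ha
        obtain ⟨y, hy, hy'⟩ := ha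
        have : a ^ g = y := by simpa [sub_eq_zero] using hy'
        rw [this, hYσ y hy]
    have hval : (X * R).derivative.eval a
        = H.eval (a ^ g) + g * a ^ g * H.derivative.eval (a ^ g) := by
      rw [hRH, derivative_mul, derivative_comp, derivative_X, derivative_X_pow]
      simp only [one_mul, eval_add, eval_mul, eval_comp, eval_X, eval_pow, eval_C]
      rw [← mul_pow_sub_one hg0 a]
      ring
    rw [one_mul, ← hσ, hval, map_add, map_mul, map_mul, map_natCast, hag,
      eval_fixed_of_map_eq hHσ hag, eval_fixed_of_map_eq (by rw [← derivative_map, hHσ]) hag]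
  · intro e he f hf
    refine ⟨e + q * f, ?_, fun _ _ => rfl⟩
    have : q * f ≤ q * (k - 1) := Nat.mul_le_mul_left _ (by omega)
    omega

/-- The evaluation set is a union of `t` cosets of the subfield of order `q`, described as fibres
of `x ↦ x ^ q - x`, whose image is the `σ`-anti-invariant line spanned by `θ`. -/
theorem hasNestedPair_additive_cosets {σ : F →+* F} (hF : Fintype.card F = q ^ 2)
    (hσ : ∀ x, σ x = x ^ q) (hσ2 : ∀ x, σ (σ x) = x) {p m : ℕ} (hp : p.Prime)
    (hq : q = p ^ m) (hq1 : 1 < q) {t k : ℕ} (ht : t ≤ q) (hk1 : 1 ≤ k)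
    (h : k + q * (k - 1) + 1 ≤ t * q) : HasNestedPair F q (t * q) k k := by
  have hK := card_filter_fixed hF hσ hp hq hq1
  obtain ⟨Z, hZs, hZc⟩ := Finset.exists_subset_card_eq (hK.symm ▸ ht)
  have hZσ : ∀ z ∈ Z, σ z = z := fun z hz => by simpa using hZs hz
  -- The elements `θ * z` with `σ z = z` are those that `σ` negates.
  obtain ⟨x, hx⟩ : ∃ x, σ x ≠ x := by
    by_contra! hall
    rw [Finset.filter_true_of_mem fun x _ => hall x, Finset.card_univ, hF] at hK
    nlinarith
  obtain ⟨θ, hθ0, hθ⟩ : ∃ θ : F, θ ≠ 0 ∧ σ θ = -θ :=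
    ⟨σ x - x, sub_ne_zero.2 hx, by rw [map_sub, hσ2, neg_sub]⟩
  set H : F[X] := ∏ z ∈ Z, (X - C z) with hH
  have hHσ : H.map σ = H := map_prod_X_sub_C_eq hZσ
  set P : F[X] := ∏ y ∈ Z.image (θ * ·), (X ^ q - X - C y) with hP
  have hPm : P.Monic := monic_prod_of_monic _ _ fun y _ => monic_X_pow_sub_X_sub_C hq1 y
  have hPd : P.natDegree = t * q := by
    rw [hP, natDegree_prod_of_monic _ _ fun y _ => monic_X_pow_sub_X_sub_C hq1 y,
      Finset.sum_congr rfl fun y _ => natDegree_X_pow_sub_X_sub_C hq1 y, Finset.sum_const,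
      Finset.card_image_of_injective _ (mul_right_injective₀ hθ0), hZc, smul_eq_mul]
  have hPdvd : P ∣ X ^ Fintype.card F - X := by
    refine prod_sub_C_dvd fun y hy => ?_
    obtain ⟨z, hz, rfl⟩ := Finset.mem_image.1 hy
    exact X_pow_sub_X_sub_C_dvd hF hσ hp hq (by rw [map_mul, hθ, hZσ z hz, neg_mul])
  have hPH : P = C (θ ^ t) * H.comp (C θ⁻¹ * (X ^ q - X)) := by
    rw [hP, Finset.prod_image (mul_right_injective₀ hθ0).injOn, hH, prod_comp, C_pow, ← hZc,
      ← Finset.prod_const, ← Finset.prod_mul_distrib]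
    refine Finset.prod_congr rfl fun z _ => ?_
    rw [sub_comp, X_comp, C_comp, mul_sub, ← mul_assoc, ← C_mul, ← C_mul, mul_inv_cancel₀ hθ0,
      C_1, one_mul]
  have hq0 : (q : F) = 0 := by
    have h1 : ((q ^ 2 : ℕ) : F) = 0 := by rw [← hF, FiniteField.cast_card_eq_zero]
    simpa using h1
  have hkq : k - 1 ≤ q * (k - 1) := Nat.le_mul_of_pos_left _ (by omega)
  rw [← hPd]
  refine hasNestedPair_of_dvd hF hσ hPm hPdvd (c := (θ ^ t)⁻¹ * θ)
    (mul_ne_zero (inv_ne_zero (pow_ne_zero _ hθ0)) hθ0) ?_ le_rfl (by omega) ?_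
  · intro a _
    have hfix : σ (θ⁻¹ * (a ^ q - a)) = θ⁻¹ * (a ^ q - a) := by
      rw [map_mul, map_inv₀, hθ, map_sub, ← hσ, hσ2, inv_neg]
      ring
    have hval : (θ ^ t)⁻¹ * θ * P.derivative.eval a
        = - H.derivative.eval (θ⁻¹ * (a ^ q - a)) := by
      rw [hPH, derivative_C_mul, derivative_comp, derivative_C_mul, derivative_sub,
        derivative_X_pow, derivative_X]
      simp only [eval_mul, eval_comp, eval_C, eval_sub, eval_pow, eval_X, eval_one, hq0, zero_mul,
        zero_sub]
      field_simp
    rw [hval, ← hσ, map_neg, eval_fixed_of_map_eq (by rw [← derivative_map, hHσ]) hfix]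
  · intro e he f hf
    refine ⟨e + q * f, ?_, fun _ _ => rfl⟩
    have : q * f ≤ q * (k - 1) := Nat.mul_le_mul_left _ (by omega)
    omega

/-- For `q + 1 = r b` with `b = 2 j + 1` odd, no exponent `e + q f ≠ 0` occurring in the Hermitian
products of polynomials of degree less than `k` is divisible by `r (q - 1)`. -/
theorem not_dvd_add_mul {r j k e f : ℕ} (hq1 : 1 < q) (hr : q + 1 = r * (2 * j + 1))
    (hk : 2 * k ≤ q + r - 1) (hne : (r, k) ≠ (q + 1, q)) (he : e < k) (hf : f < k)
    (h0 : e + q * f ≠ 0) : ¬ r * (q - 1) ∣ e + q * f := by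
  intro hdvd
  have hr0 : 1 ≤ r := by
    rcases Nat.eq_zero_or_pos r with rfl | h
    · omega
    · exact h
  have hsplit : e + q * f = (e + f) + (q - 1) * f := by
    obtain ⟨c, rfl⟩ := Nat.exists_eq_add_of_le' hq1.le
    simp only [Nat.add_sub_cancel]
    ring
  have h1 : q - 1 ∣ e + f := by
    have := (Dvd.intro_left r rfl).trans hdvd
    rw [hsplit] at this
    exact (Nat.dvd_add_left (Dvd.intro f rfl)).1 this
  have hlt : e + f < 2 * (q - 1) := by
    rcases Nat.eq_zero_or_pos j with rfl | hj
    · have : k ≠ q := fun h => hne (by rw [h]; simp; omega)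
      omega
    · have : r * 3 ≤ r * (2 * j + 1) := Nat.mul_le_mul_left _ (by omega)
      omega
  obtain ⟨c, hc⟩ := h1
  have hc2 : c < 2 := by
    by_contra hge
    have : (q - 1) * 2 ≤ (q - 1) * c := Nat.mul_le_mul_left _ (by omega)
    omega
  interval_cases c
  · have : e = 0 ∧ f = 0 := by omega
    simp [this] at h0
  · have hef : e + q * f = (f + 1) * (q - 1) := by
      rw [hsplit, hc]
      ring
    rw [hef] at hdvd
    obtain ⟨d, hd⟩ := Nat.dvd_of_mul_dvd_mul_right (by omega) hdvd
    have e1 : r * (2 * j + 1) = 2 * (r * j) + r := by ring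
    -- The bounds on `f` squeeze `d` strictly between `j` and `j + 1`.
    have hdj : d < j + 1 := by
      by_contra hge
      have : r * (j + 1) ≤ r * d := Nat.mul_le_mul_left _ (by omega)
      rw [mul_add, mul_one] at this
      omega
    have hjd : j < d := by
      by_contra hge
      have : r * d ≤ r * j := Nat.mul_le_mul_left _ (by omega)
      omega
    omega

/-- The evaluation set consists of `0` and the roots of unity of order `r (q - 1)`. -/
theorem hasNestedPair_roots_of_unity {σ : F →+* F} (hF : Fintype.card F = q ^ 2)
    (hσ : ∀ x, σ x = x ^ q) (hq1 : 1 < q) {r j k : ℕ} (hr : q + 1 = r * (2 * j + 1))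
    (hk : 2 * k ≤ q + r - 1) (hne : (r, k) ≠ (q + 1, q)) :
    HasNestedPair F q (r * (q - 1) + 1) k k := by
  have hr0 : 1 ≤ r := by
    rcases Nat.eq_zero_or_pos r with rfl | h
    · omega
    · exact h
  set M := r * (q - 1) with hM
  have hM1 : q - 1 ≤ M := Nat.le_mul_of_pos_left _ hr0
  have hM2 : r ≤ M := Nat.le_mul_of_pos_right _ (by omega)
  have hM0 : M ≠ 0 := by omega
  have hm1 : (X ^ M - 1 : F[X]).Monic := monic_X_pow_sub_C 1 hM0
  have hd1 : (X ^ M - 1 : F[X]).natDegree = M := natDegree_X_pow_sub_C (r := (1 : F))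
  have hPm : (X * (X ^ M - 1) : F[X]).Monic := monic_X.mul hm1
  have hPd : (X * (X ^ M - 1) : F[X]).natDegree = M + 1 := by
    rw [monic_X.natDegree_mul hm1, natDegree_X, hd1, add_comm]
  have hPdvd : (X * (X ^ M - 1) : F[X]) ∣ X ^ Fintype.card F - X := by
    refine X_mul_dvd_of_dvd hF hq1 ?_
    have : (X ^ ((q + 1) * (q - 1)) - 1 : F[X]) = (X ^ M) ^ (2 * j + 1) - 1 ^ (2 * j + 1) := by
      rw [one_pow, ← pow_mul, hr, hM]
      ring
    rw [this]
    exact sub_dvd_pow_sub_pow _ _ _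
  have hroot : ∀ a : F, (X * (X ^ M - 1) : F[X]).eval a = 0 → a = 0 ∨ a ^ M = 1 := by
    intro a ha
    simpa [sub_eq_zero] using ha
  rw [← hPd]
  refine hasNestedPair_of_dvd hF hσ hPm hPdvd one_ne_zero ?_ le_rfl (by omega) ?_
  · intro a ha
    have hfix : σ (a ^ M) = a ^ M := by
      rcases hroot a ha with rfl | h
      · simp [hM0]
      · rw [h, map_one]
    have hval : (X * (X ^ M - 1) : F[X]).derivative.eval a = (a ^ M - 1) + M * a ^ M := by
      rw [derivative_mul, derivative_X, derivative_sub, derivative_X_pow, derivative_one]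
      simp only [one_mul, sub_zero, eval_add, eval_mul, eval_sub, eval_X, eval_pow, eval_C,
        eval_one]
      rw [← mul_pow_sub_one hM0 a]
      ring
    rw [one_mul, ← hσ, hval, map_add, map_sub, map_mul, map_one, map_natCast, hfix]
  · intro e he f hf
    rcases eq_or_ne (e + q * f) 0 with h0 | h0
    · exact ⟨0, by omega, fun _ _ => by rw [h0]⟩
    · have hnd := not_dvd_add_mul hq1 hr hk hne he hf h0
      have hmod : (e + q * f) % M ≠ 0 := fun h => hnd (Nat.dvd_of_mod_eq_zero h)
      have hlt := Nat.mod_lt (e + q * f) (Nat.pos_of_ne_zero hM0)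
      refine ⟨(e + q * f) % M, by omega, fun a ha => ?_⟩
      rcases hroot a ha with rfl | h
      · rw [zero_pow h0, zero_pow hmod]
      · conv_lhs => rw [← Nat.mod_add_div (e + q * f) M, pow_add, pow_mul, h, one_pow, mul_one]

end Families

/-! ### The parameter families -/

section Parameters

variable {F : Type*} [Field F] [DecidableEq F] {q : ℕ}

/-- The lengths `g T + 1` and `g T + 2`. For the latter, the codes of length `n - 1` are what
puncturing and shortening at the point at infinity would leave. -/
theorem hasNestedPair_or_of_dvd [Fintype F] {σ : F →+* F} (hF : Fintype.card F = q ^ 2)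
    (hσ : ∀ x, σ x = x ^ q) {p m : ℕ} (hp : p.Prime) (hq : q = p ^ m) (hq1 : 1 < q)
    {g T i n k : ℕ} (hg : g ∣ q + 1) (hT : T ≤ q - 1) (hn : n = g * T + i) (hi1 : 1 ≤ i)
    (hi2 : i ≤ 2) (hk1 : 1 ≤ k) (hk : k * (q + 1) ≤ n + q - 1) :
    HasNestedPair F q n k k ∨ HasNestedPair F q (n - 1) k (k - 1) := by
  obtain ⟨k, rfl⟩ := Nat.exists_eq_add_of_le' hk1
  have e1 : (k + 1) * (q + 1) = q * k + k + q + 1 := by ring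
  rw [e1] at hk
  obtain rfl | rfl : i = 1 ∨ i = 2 := by omega
  · left
    rw [hn]
    exact hasNestedPair_power_fibres hF hσ hp hq hq1 hg hT le_rfl hk1 (by simp; omega)
  · right
    rw [show n - 1 = g * T + 1 by omega]
    exact hasNestedPair_power_fibres hF hσ hp hq hq1 hg hT (by omega) hk1 (by simp; omega)

/-- Both kinds of initial pair lead to the same pair of length `n - s`, because `s ≥ 1`. -/
theorem HasNestedPair.shorten_le {σ : F →+* F} (hσ : ∀ x, σ x = x ^ q)
    (hσ2 : ∀ x, σ (σ x) = x) {n k s : ℕ} (hs1 : 1 ≤ s) (hs2 : s ≤ k - 1)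
    (h : HasNestedPair F q n k k ∨ HasNestedPair F q (n - 1) k (k - 1)) :
    HasNestedPair F q (n - s) k (k - s) := by
  rcases h with h | h
  · have := h.add_le hσ hσ2
    refine HasNestedPair.iterate hσ hσ2 s ?_
    rwa [Nat.sub_add_cancel (by omega), Nat.sub_add_cancel (by omega)]
  · have := h.add_le hσ hσ2
    refine HasNestedPair.iterate hσ hσ2 (s - 1) ?_
    rwa [show n - s + (s - 1) = n - 1 by omega, show k - s + (s - 1) = k - 1 by omega]

theorem exists_odd_cofactor {r : ℕ} (h : (q : ℤ) ≡ (r : ℤ) - 1 [ZMOD 2 * (r : ℤ)]) :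
    ∃ j, q + 1 = r * (2 * j + 1) := by
  obtain ⟨c, hc⟩ := h.dvd
  have h1 : ((q : ℤ) + 1) = r * (2 * (-c) + 1) := by linarith
  have h2 : 0 ≤ -c := by
    by_contra hneg
    have h3 : (r : ℤ) * (2 * (-c) + 1) ≤ 0 :=
      mul_nonpos_of_nonneg_of_nonpos (Int.natCast_nonneg r) (by omega)
    omega
  obtain ⟨j, hj⟩ := Int.eq_ofNat_of_zero_le h2
  refine ⟨j, ?_⟩
  rw [hj] at h1
  exact_mod_cast h1

theorem div_gcd_dvd_sub_one {N : ℕ} (hq1 : 1 < q) (hN : N ∣ q ^ 2 - 1) :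
    N / N.gcd (q + 1) ∣ q - 1 := by
  have hpos : 0 < N.gcd (q + 1) := Nat.gcd_pos_of_pos_right _ (by omega)
  refine (Nat.coprime_div_gcd_div_gcd hpos).dvd_of_dvd_mul_left ?_
  obtain ⟨d, hd⟩ := hN
  refine ⟨d, Nat.eq_of_mul_eq_mul_left hpos ?_⟩
  rw [← mul_assoc, ← mul_assoc, Nat.mul_div_cancel' (Nat.gcd_dvd_right _ _),
    Nat.mul_div_cancel' (Nat.gcd_dvd_left _ _), ← hd]
  simpa using (Nat.sq_sub_sq q 1).symm

end Parameters

end LinCode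

open LinCode in
theorem mainTheorem8 {F : Type*} [Field F] [Fintype F] [DecidableEq F]
    (p m q : ℕ) (hp : p.Prime) (hm : 1 ≤ m) (hq : q = p ^ m) (hq2 : 2 < q)
    (hF : Fintype.card F = q ^ 2)
    (n k : ℕ)
    (hnk :
      (n = q ^ 2 + 1 ∧ k ≤ q ∧ k ≠ q - 1) ∨
      (∃ r : ℕ, n = r * (q - 1) + 1 ∧ 2 * k ≤ q + r - 1 ∧
        (q : ℤ) ≡ (r : ℤ) - 1 [ZMOD 2 * (r : ℤ)] ∧ (r, k) ≠ (q + 1, q)) ∨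
      (3 * n = q ^ 2 + 2 ∧ 3 ∣ q + 1 ∧ 3 * k ≤ 2 * q - 1) ∨
      (∃ t : ℕ, n = t * q ∧ 1 ≤ t ∧ t ≤ q ∧ k ≤ (t * q + q - 1) / (q + 1)) ∨
      (∃ t : ℕ, n = t * (q + 1) + 2 ∧ 1 ≤ t ∧ t ≤ q - 1 ∧ k ≤ t + 1 ∧
        (p, t, k) ≠ (2, q - 1, q - 1)) ∨
      (n - 1 ∣ q ^ 2 - 1 ∧ k ≤ (n + q - 1) / (q + 1)) ∨
      (∃ t N i n₂ : ℕ, n = (t + 1) * N + i ∧ 1 ≤ i ∧ i ≤ 2 ∧ N ∣ q ^ 2 - 1 ∧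
        n₂ = N / Nat.gcd N (q + 1) ∧ 1 ≤ t ∧ t ≤ (q - 1) / n₂ - 1 ∧
        k ≤ (n + q - 1) / (q + 1)))
    (s l : ℕ) (hs1 : 1 ≤ s) (hs2 : s ≤ k - 1) (hl : l ≤ k - s) :
    (∃ C : LinCode F (n - s),
      C.HasParams (k - s) (n - k + 1) ∧ C.IsMDS ∧ C.IsHermHullDim q l) ∧
    (∃ C : LinCode F (n - s),
      C.HasParams (n - k - s) (k + 1) ∧ C.IsMDS ∧ C.IsHermHullDim q l) ∧
    (∃ C : LinCode F (n - s),
      C.HasParams (n - k) (k - s + 1) ∧ C.IsMDS ∧ C.IsHermHullDim q l) := by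
  obtain ⟨σ, hσ, hσ2⟩ := exists_conj hp hq hF
  have hq1 : 1 < q := by omega
  have hk1 : 1 ≤ k := by omega
  have start : HasNestedPair F q n k k ∨ HasNestedPair F q (n - 1) k (k - 1) := by
    have fibres := fun {g T i : ℕ} => hasNestedPair_or_of_dvd (g := g) (T := T) (i := i) (n := n)
      (k := k) hF hσ hp hq hq1
    rcases hnk with ⟨hn, hk, -⟩ | ⟨r, hn, hk, hr, hne⟩ | ⟨hn, ⟨r, hr⟩, hk⟩ |
      ⟨t, hn, -, ht, hk⟩ | ⟨t, hn, -, ht, hk, -⟩ | ⟨hN, hk⟩ |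
      ⟨t, N, i, n₂, hn, hi1, hi2, hN, hn₂, ht1, ht, hk⟩
    -- The case `A = F`: every nonzero element has its `(q + 1)`-th power in the subfield.
    · have e1 := sq_eq_mul_sub_one_add_one hq1.le
      refine fibres (g := q + 1) (T := q - 1) (i := 2) dvd_rfl le_rfl (by omega) (by omega) le_rfl
        hk1 ?_
      have : k * (q + 1) ≤ q * (q + 1) := Nat.mul_le_mul_right _ hk
      have e2 : q * (q + 1) = q ^ 2 + q := by ring
      omega
    · obtain ⟨j, hj⟩ := exists_odd_cofactor hr
      left
      rw [hn]
      exact hasNestedPair_roots_of_unity hF hσ hq1 hj hk hne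
    -- Here `3 * r = q + 1`, so the cofactor of `r` is the odd number `3`.
    · left
      have e1 : n = r * (q - 1) + 1 := by
        obtain rfl : q = 3 * r - 1 := by omega
        obtain ⟨c, rfl⟩ : ∃ c, r = c + 1 := ⟨r - 1, by omega⟩
        simp only [show 3 * (c + 1) - 1 = 3 * c + 2 by omega] at hn ⊢
        simp only [show 3 * c + 2 - 1 = 3 * c + 1 by omega]
        nlinarith
      rw [e1]
      refine hasNestedPair_roots_of_unity hF hσ hq1 (j := 1) (by omega) (by omega) ?_
      intro h
      have := congrArg Prod.fst h
      simp only at this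
      omega
    · left
      rw [hn]
      rw [Nat.le_div_iff_mul_le (by omega)] at hk
      obtain ⟨k, rfl⟩ := Nat.exists_eq_add_of_le' hk1
      have e1 : (k + 1) * (q + 1) = q * k + k + q + 1 := by ring
      rw [e1] at hk
      refine hasNestedPair_additive_cosets hF hσ hσ2 hp hq hq1 ht hk1 ?_
      simp only [Nat.add_sub_cancel]
      omega
    · refine fibres (g := q + 1) (T := t) (i := 2) dvd_rfl ht (by rw [hn, mul_comm]) (by omega)
        le_rfl hk1 ?_
      have : k * (q + 1) ≤ (t + 1) * (q + 1) := Nat.mul_le_mul_right _ hk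
      have e2 : (t + 1) * (q + 1) = t * (q + 1) + q + 1 := by ring
      omega
    · rw [Nat.le_div_iff_mul_le (by omega)] at hk
      have hn1 : 1 ≤ n := by
        have : 1 * (q + 1) ≤ k * (q + 1) := Nat.mul_le_mul_right _ hk1
        omega
      refine fibres (Nat.gcd_dvd_right (n - 1) (q + 1))
        (Nat.le_of_dvd (by omega) (div_gcd_dvd_sub_one hq1 hN)) (i := 1) ?_ le_rfl (by omega) hk1 hk
      rw [Nat.mul_div_cancel' (Nat.gcd_dvd_left _ _)]
      omega
    · rw [Nat.le_div_iff_mul_le (by omega)] at hk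
      -- Only the number `(t + 1) * n₂` of fibres of `x ↦ x ^ g` with `g = gcd N (q + 1)` matters:
      -- the evaluation set need not be a union of cosets of the `N`-th roots of unity.
      have hT : (t + 1) * n₂ ≤ q - 1 := Nat.mul_le_of_le_div _ _ _ (by omega)
      refine fibres (Nat.gcd_dvd_right N (q + 1)) hT ?_ hi1 hi2 hk1 hk
      rw [hn, hn₂, mul_left_comm, Nat.mul_div_cancel' (Nat.gcd_dvd_left _ _)]
  have hpair := HasNestedPair.shorten_le hσ hσ2 hs1 hs2 start
  have hle := hpair.add_le hσ hσ2
  obtain ⟨u, hu⟩ := exists_unit_pow_add_one_ne_one hF hq2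
  obtain ⟨⟨C₁, h₁, h₁'⟩, ⟨C₂, h₂, h₂'⟩, ⟨C₃, h₃, h₃'⟩⟩ := hpair.exists_codes hσ hσ2 hu hl
  have p₁ := h₁.hasParams (by omega)
  have p₂ := h₂.hasParams (by omega)
  have p₃ := h₃.hasParams (by omega)
  rw [show n - s - (k - s) + 1 = n - k + 1 by omega] at p₁
  rw [show n - s - (n - s - k) + 1 = k + 1 by omega, show n - s - k = n - k - s by omega] at p₂
  rw [show n - s - (n - s - (k - s)) + 1 = k - s + 1 by omega,
    show n - s - (k - s) = n - k by omega] at p₃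
  exact ⟨⟨C₁, p₁, h₁.isMDS (by omega), h₁'⟩, ⟨C₂, p₂, h₂.isMDS (by omega), h₂'⟩,
    ⟨C₃, p₃, h₃.isMDS (by omega), h₃'⟩⟩
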